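/- Theorem (A non-Fuchsian matrix discrete Painlevé II system). Setting. Let $dm(\zeta)=\frac{d\zeta}{2\pi i\zeta}$ on the unit circle $\mathbb T$, and let $w:\mathbb C\setminus\{0\}\to\mathbb C^{N\times N}$ be analytic with invertible values. Its moments are $\hat\mu(j)=\oint_{\mathbb T}\bar\zeta^{\,j}w(\zeta)\,dm(\zeta)$, $j\in\mathbb Z$; $w$ is called quasi-definite if the block Toeplitz matrices $(\hat\mu(i-j))_{0\le i,j<n}$ and $(\hat\mu(j-i))_{0\le i,j<n}$ are nonsingular for all $n\ge 1$. For quasi-definite $w$ let $P^L_{1,n}(z)=I z^n+\cdots$ and $P^R_{2,n}(z)=Iz^n+\cdots$ be the monic matrix Szegő polynomials of degree $n$ determined by $$\oint_{\mathbb T}P^L_{1,n}(\zeta)w(\zeta)\bar\zeta^{\,j}\,dm(\zeta)=0,\qquad \oint_{\mathbb T}\big(P^R_{2,n}(\zeta)\big)^\dagger w(\zeta)\zeta^{j}\,dm(\zeta)=0,\qquad 0\le j\le n-1,$$ and let $\alpha^L_{1,n}=P^L_{1,n}(0)$ and $\alpha^R_{2,n}=P^R_{2,n}(0)$ be the corresponding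 Verblunsky matrices (so $\alpha^L_{1,0}=\alpha^R_{2,0}=I$). (i) Let $W_{-2},W_{-1},W_0\in\mathbb C^{N\times N}$ be such that the Pearson system $\frac{dw}{dz}=W(z)w$ with $W(z)=W_{-2}z^{-2}+W_{-1}z^{-1}+W_0$ is monodromy free (every solution continued once around the origin returns to itself). If $w$ is quasi-definite and has right logarithmic derivative $w'(z)w(z)^{-1}=W(z)$ on $\mathbb C\setminus\{0\}$, then for all $n\ge 1$ $$(W_{-1}+nI)\alpha^L_{1,n}+W_0\alpha^L_{1,n+1}-\alpha^L_{1,n-1}W_{-2}=W_0\Big(\alpha^L_{1,n+1}(\alpha^R_{2,n})^\dagger\alpha^L_{1,n}+\alpha^L_{1,n}(\alpha^R_{2,n-1})^\dagger\alpha^L_{1,n}\Big)+\Big[W_0,\sum_{m=1}^{n-1}\alpha^L_{1,m}(\alpha^R_{2,m-1})^\dagger\Big]\alpha^L_{1,n},$$ $$(\alpha^R_{2,n})^\dagger(W_{-1}+nI)+(\alpha^R_{2,n-1})^\dagger W_0-W_{-2}(\alpha^R_{2,n+1})^\dagger=\Big((\alpha^R_{2,n})^\dagger\alpha^L_{1,n}(\alpha^R_{2,n-1})^\dagger+(\alpha^R_{2,n})^\dagger\alpha^L_{1,n+1}(\alpha^R_{2,n})^\dagger\Big)W_0+(\alpha^R_{2,n})^\dagger\Big[W_0,\sum_{m=1}^{n+1}\alpha^L_{1,m}(\alpha^R_{2,m-1})^\dagger\Big].$$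 (ii) Scalar real reduction. Let $N=1$, $k\in\mathbb R$, $W_0=-W_{-2}=k$ and $W_{-1}=0$, and let $w$ be analytic and nowhere zero on $\mathbb C\setminus\{0\}$ with $w'(z)w(z)^{-1}=k-kz^{-2}$. Then $w$ is quasi-definite, $\alpha^L_{1,n}=\alpha^R_{2,n}=:\alpha_n$ is real for all $n\ge 0$, and for all $n\ge 1$ one has $\alpha_n^2\ne 1$ and $$n\,\frac{\alpha_n}{1-\alpha_n^2}+k\,(\alpha_{n+1}+\alpha_{n-1})=0.$$ -/

import Mathlib

open Matrix Polynomial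

noncomputable section

namespace SzegoMatrix

/-- Square complex matrices of size `N`. -/
abbrev Mat (N : ℕ) : Type := Matrix (Fin N) (Fin N) ℂ

/-- The entrywise integral over the unit circle of a matrix function against the normalized
Lebesgue measure `dm = dζ / (2 π i ζ)`. -/
def circInt {N : ℕ} (F : ℂ → Mat N) : Mat N :=
  Matrix.of fun i j => Real.circleAverage (fun ζ => F ζ i j) 0 1

/-- The moments (Fourier coefficients) of the matrix of measures `w dm`. -/
def moment {N : ℕ} (w : ℂ → Mat N) (j : ℤ) : Mat N :=
  circInt fun ζ => (star ζ) ^ j • w ζ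

/-- The truncated left moment matrix, with block `(i, j)` equal to the moment of index `i - j`. -/
def momentL {N : ℕ} (w : ℂ → Mat N) (n : ℕ) : Matrix (Fin n × Fin N) (Fin n × Fin N) ℂ :=
  Matrix.of fun p q => moment w ((p.1 : ℤ) - (q.1 : ℤ)) p.2 q.2

/-- The truncated right moment matrix, with block `(i, j)` equal to the moment of index `j - i`. -/
def momentR {N : ℕ} (w : ℂ → Mat N) (n : ℕ) : Matrix (Fin n × Fin N) (Fin n × Fin N) ℂ :=
  Matrix.of fun p q => moment w ((q.1 : ℤ) - (p.1 : ℤ)) p.2 q.2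

/-- Quasi-definiteness of the matrix of measures `w dm`. -/
def QuasiDefinite {N : ℕ} (w : ℂ → Mat N) : Prop :=
  ∀ n : ℕ, 1 ≤ n → (momentL w n).det ≠ 0 ∧ (momentR w n).det ≠ 0

/-- The value at the complex number `z` of a polynomial with matrix coefficients. -/
def evalAt {N : ℕ} (P : (Mat N)[X]) (z : ℂ) : Mat N :=
  P.eval (Matrix.scalar (Fin N) z)

/-- `P = I zⁿ + (lower order terms)`. -/
def MonicOfDegree {N : ℕ} (P : (Mat N)[X]) (n : ℕ) : Prop :=
  P.natDegree ≤ n ∧ P.coeff n = 1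

/-- The defining property of the first left Szegő polynomial of degree `n`. -/
def IsSzegoL1 {N : ℕ} (w : ℂ → Mat N) (n : ℕ) (P : (Mat N)[X]) : Prop :=
  MonicOfDegree P n ∧
    ∀ j : ℕ, j < n → circInt (fun ζ => (star ζ) ^ j • (evalAt P ζ * w ζ)) = 0

/-- The defining property of the second right Szegő polynomial of degree `n`. -/
def IsSzegoR2 {N : ℕ} (w : ℂ → Mat N) (n : ℕ) (P : (Mat N)[X]) : Prop :=
  MonicOfDegree P n ∧
    ∀ j : ℕ, j < n → circInt (fun ζ => ζ ^ j • ((evalAt P ζ)ᴴ * w ζ)) = 0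

/-- The first left Szegő polynomial; it exists and is unique when `w` is quasi-definite. -/
def szegoL1 {N : ℕ} (w : ℂ → Mat N) (n : ℕ) : (Mat N)[X] :=
  Classical.epsilon (IsSzegoL1 w n)

/-- The second right Szegő polynomial; it exists and is unique when `w` is quasi-definite. -/
def szegoR2 {N : ℕ} (w : ℂ → Mat N) (n : ℕ) : (Mat N)[X] :=
  Classical.epsilon (IsSzegoR2 w n)

/-- The Verblunsky matrix of the first left family. -/
def verblunskyL1 {N : ℕ} (w : ℂ → Mat N) (n : ℕ) : Mat N := evalAt (szegoL1 w n) 0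

/-- The Verblunsky matrix of the second right family. -/
def verblunskyR2 {N : ℕ} (w : ℂ → Mat N) (n : ℕ) : Mat N := evalAt (szegoR2 w n) 0

/-- The weight is analytic on the punctured plane, with an analytic inverse there
(the value at `0` is irrelevant). -/
def IsAnnulusWeight {N : ℕ} (w : ℂ → Mat N) : Prop :=
  (∀ i j, DifferentiableOn ℂ (fun z => w z i j) {0}ᶜ) ∧ ∀ z, z ≠ 0 → IsUnit (w z)

/-- The right logarithmic derivative `w' w⁻¹`. -/
def rightLogDeriv {N : ℕ} (w : ℂ → Mat N) (z : ℂ) : Mat N :=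
  (Matrix.of fun i j => deriv (fun t => w t i j) z) * (w z)⁻¹

/-- The Pearson system `y' = W y` on the punctured plane is monodromy free: each solution on the
universal cover `exp : ℂ → ℂ ∖ {0}` returns to its value after one turn around the origin.
In the coordinate `u`, with `z = exp u`, the system reads `dy/du = exp u • W (exp u) y`. -/
def MonodromyFree {N : ℕ} (W : ℂ → Mat N) : Prop :=
  ∀ y : ℂ → Fin N → ℂ,
    (∀ u, HasDerivAt y (Complex.exp u • (W (Complex.exp u) *ᵥ y u)) u) →
      ∀ u, y (u + 2 * Real.pi * Complex.I) = y u

/-- `W(z) = W₋₂ z⁻² + W₋₁ z⁻¹ + W₀`. -/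
def laurentW {N : ℕ} (Wm2 Wm1 W0 : Mat N) (z : ℂ) : Mat N :=
  (z ^ 2)⁻¹ • Wm2 + z⁻¹ • Wm1 + W0

/-- The commutator. -/
def comm {N : ℕ} (A B : Mat N) : Mat N := A * B - B * A

end SzegoMatrix

end

/-! On the unit circle `pairing (moment w) m P` is ∮ P w ζ̄^m dm, so orthogonality becomes linear
algebra over the moment sequence. Integrating the Pearson equation by parts gives a three-term
recursion for the moments (`moment_recursion`), and the matrix equations need nothing else from it.
Since z²(Pw)' = (`pearsonOp` P) w, the recursion makes `pearsonOp` respect orthogonality up to a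
shift by one (`pairing_pearsonOp`).

Write P_n for the left polynomials, Q_n for the reversed right ones, α_n = P_n(0), and β_n for the
coefficient of z^n in Q_n. A polynomial of degree at most n that vanishes at 0 and is orthogonal to
ζ, …, ζ^n is zero (`eq_zero_of_shift`). Matching the top and constant coefficients therefore proves
the Szegő recursions, and expands `pearsonOp` of P_n and of Q_n in zP_{n+1}, zP_n and Q_n,
respectively zP_{n+1} and Q_{n+1}. Comparing coefficients of z gives the first Painlevé equation,
comparing leading coefficients the second. The sums in the commutators are subleading coefficients
of the P_n (`subleading_left`).

In the scalar case w is a nonzero constant times exp(k(z + 1/z)), which is positive on the circle.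
Its Toeplitz forms are positive definite, so w is quasi-definite; its moments are real and
symmetric, so both Verblunsky families are real and coincide. The commutators vanish, and
`verblunsky_mul_ne_one` permits division by 1 - α_n². -/

noncomputable section

namespace SzegoMatrix

variable {N : ℕ}

/-! ### Moment pairing and the Pearson operator -/

/-- The pairing of a matrix polynomial with `ζ̄ ^ m` against the moment sequence `c`. -/
def pairing (c : ℤ → Mat N) (m : ℤ) : (Mat N)[X] →+ Mat N where
  toFun P := P.sum fun k a => a * c (m - k)
  map_zero' := by simp
  map_add' P Q := Polynomial.sum_add_index P Q _ (by simp) (by simp [add_mul])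

lemma pairing_monomial (c : ℤ → Mat N) (m : ℤ) (k : ℕ) (a : Mat N) :
    pairing c m (monomial k a) = a * c (m - k) := by
  simp [pairing, Polynomial.sum_monomial_index]

lemma pairing_eq_sum_range (c : ℤ → Mat N) (m : ℤ) (P : (Mat N)[X]) (n : ℕ)
    (h : ∀ k, n ≤ k → P.coeff k = 0) :
    pairing c m P = ∑ k ∈ Finset.range n, P.coeff k * c (m - k) := by
  refine Polynomial.sum_eq_of_subset (fun k a => a * c (m - k)) (by simp) ?_
  intro k hk
  by_contra hk'
  exact (mem_support_iff.1 hk) (h k (by simpa using hk'))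

lemma pairing_C_mul (c : ℤ → Mat N) (m : ℤ) (A : Mat N) (P : (Mat N)[X]) :
    pairing c m (C A * P) = A * pairing c m P := by
  induction P using Polynomial.induction_on' with
  | add P Q hP hQ => rw [mul_add, map_add, map_add, hP, hQ, mul_add]
  | monomial k a => rw [C_mul_monomial, pairing_monomial, pairing_monomial, mul_assoc]

lemma pairing_mul_X (c : ℤ → Mat N) (m : ℤ) (P : (Mat N)[X]) :
    pairing c m (P * X) = pairing c (m - 1) P := by
  induction P using Polynomial.induction_on' with
  | add P Q hP hQ => rw [add_mul, map_add, map_add, hP, hQ]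
  | monomial k a =>
    rw [monomial_mul_X, pairing_monomial, pairing_monomial]
    congr 2
    push_cast
    ring

/-- The polynomial `z² P' + P (W₋₂ + W₋₁ z + W₀ z²)`. -/
def pearsonOp (Wm2 Wm1 W0 : Mat N) (P : (Mat N)[X]) : (Mat N)[X] :=
  derivative P * X * X + P * (C Wm2 + C Wm1 * X + C W0 * X * X)

/-- Algebraic form of ∮ ζ^(2-m) (Pw)' dm = (m - 1) ∮ ζ^(1-m) P w dm, an integration by parts; `hc`
is the same identity for constant P. -/
lemma pairing_pearsonOp {c : ℤ → Mat N} {Wm2 Wm1 W0 : Mat N}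
    (hc : ∀ j : ℤ, (j : ℂ) • c j = Wm2 * c (j + 1) + Wm1 * c j + W0 * c (j - 1))
    (m : ℤ) (P : (Mat N)[X]) :
    pairing c m (pearsonOp Wm2 Wm1 W0 P) = ((m - 1 : ℤ) : ℂ) • pairing c (m - 1) P := by
  induction P using Polynomial.induction_on' with
  | add P Q hP hQ =>
    rw [map_add, smul_add, ← hP, ← hQ, ← map_add]
    congr 1
    simp only [pearsonOp, derivative_add, add_mul]
    abel
  | monomial k a =>
    have h1 : pairing c m (derivative (monomial k a) * X * X)
        = (k : ℂ) • (a * c (m - 1 - k)) := by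
      rw [pairing_mul_X, pairing_mul_X, derivative_monomial, pairing_monomial]
      rcases k with _ | k
      · simp
      · rw [Nat.add_sub_cancel, ← nsmul_eq_mul', smul_mul_assoc, ← Nat.cast_smul_eq_nsmul ℂ]
        have e : m - 1 - 1 - (k : ℤ) = m - 1 - ((k + 1 : ℕ) : ℤ) := by push_cast; ring
        rw [e]
    have h2 : monomial k a * (C Wm2 + C Wm1 * X + C W0 * X * X)
        = monomial k (a * Wm2) + monomial k (a * Wm1) * X + monomial k (a * W0) * X * X := by
      simp only [mul_add, ← mul_assoc, monomial_mul_C]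
    have h3 := hc (m - 1 - k)
    rw [pearsonOp, map_add, h1, h2, map_add, map_add, pairing_mul_X, pairing_mul_X,
      pairing_mul_X, pairing_monomial, pairing_monomial, pairing_monomial, pairing_monomial]
    have e1 : m - 1 - (k : ℤ) + 1 = m - k := by ring
    have e2 : m - 1 - (k : ℤ) - 1 = m - 1 - 1 - k := by ring
    rw [e1, e2] at h3
    have h4 : ((m - 1 : ℤ) : ℂ) • (a * c (m - 1 - k))
        = (k : ℂ) • (a * c (m - 1 - k)) + a * (((m - 1 - k : ℤ) : ℂ) • c (m - 1 - k)) := by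
      rw [mul_smul_comm, ← add_smul]
      congr 1
      push_cast
      ring
    rw [h4, h3]
    simp only [mul_add, mul_assoc]

lemma coeff_zero_pearsonOp (Wm2 Wm1 W0 : Mat N) (P : (Mat N)[X]) :
    (pearsonOp Wm2 Wm1 W0 P).coeff 0 = P.coeff 0 * Wm2 := by
  simp [pearsonOp, mul_add, ← mul_assoc]

lemma coeff_one_pearsonOp (Wm2 Wm1 W0 : Mat N) (P : (Mat N)[X]) :
    (pearsonOp Wm2 Wm1 W0 P).coeff 1 = P.coeff 1 * Wm2 + P.coeff 0 * Wm1 := by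
  simp [pearsonOp, mul_add, ← mul_assoc, coeff_mul_C, coeff_mul_X (n := 0)]

lemma coeff_add_two_pearsonOp (Wm2 Wm1 W0 : Mat N) (P : (Mat N)[X]) (k : ℕ) :
    (pearsonOp Wm2 Wm1 W0 P).coeff (k + 2) = P.coeff (k + 1) * ((k + 1 : ℕ) : Mat N)
      + (P.coeff (k + 2) * Wm2 + P.coeff (k + 1) * Wm1 + P.coeff k * W0) := by
  have h (R : (Mat N)[X]) : (R * X).coeff (k + 2) = R.coeff (k + 1) := coeff_mul_X R (k + 1)
  simp [pearsonOp, mul_add, ← mul_assoc, coeff_mul_C, h, coeff_derivative]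

/-! ### Szegő recursions and Painlevé equations for biorthogonal systems -/

/-- Two families of matrix polynomials biorthogonal with respect to a nondegenerate moment
sequence: `P n` is monic of degree `n`, and `Q n` is the reversed polynomial of the second
family, normalized by `Q n (0) = 1`. -/
structure IsSzegoSystem (c : ℤ → Mat N) (P Q : ℕ → (Mat N)[X]) : Prop where
  nondegenerate : ∀ (n : ℕ) (R : (Mat N)[X]), (∀ k, n ≤ k → R.coeff k = 0) →
    (∀ j : ℕ, j < n → pairing c j R = 0) → R = 0
  coeff_left : ∀ n k, n < k → (P n).coeff k = 0
  lead_left : ∀ n, (P n).coeff n = 1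
  orth_left : ∀ n j : ℕ, j < n → pairing c j (P n) = 0
  coeff_right : ∀ n k, n < k → (Q n).coeff k = 0
  const_right : ∀ n, (Q n).coeff 0 = 1
  orth_right : ∀ n j : ℕ, j < n → pairing c (j + 1 : ℕ) (Q n) = 0

namespace IsSzegoSystem

variable {c : ℤ → Mat N} {P Q : ℕ → (Mat N)[X]} (h : IsSzegoSystem c P Q)
include h

/-- Dividing by z lowers both the degree and the orthogonality indices by one, which reduces the
claim to nondegeneracy. Every identity below is proved by applying this to the difference of its two
sides. -/
lemma eq_zero_of_shift (n : ℕ) (R : (Mat N)[X]) (h0 : R.coeff 0 = 0)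
    (hd : ∀ k, n < k → R.coeff k = 0)
    (ho : ∀ j : ℕ, j < n → pairing c (j + 1 : ℕ) R = 0) : R = 0 := by
  have hR : R = R.divX * X := by
    conv_lhs => rw [← divX_mul_X_add R, h0, C_0, add_zero]
  have : R.divX = 0 := by
    refine h.nondegenerate n _ (fun k hk => ?_) (fun j hj => ?_)
    · rw [coeff_divX]; exact hd _ (by omega)
    · have := ho j hj
      rw [hR, pairing_mul_X] at this
      simpa using this
  rw [hR, this, zero_mul]

lemma pairing_left_mul_X (n j : ℕ) (hj : j < n) :
    pairing c (j + 1 : ℕ) (P n * X) = 0 := by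
  rw [pairing_mul_X]
  simpa using h.orth_left n j hj

lemma left_succ (n : ℕ) : P (n + 1) = P n * X + C ((P (n + 1)).coeff 0) * Q n := by
  rw [← sub_eq_zero]
  refine h.eq_zero_of_shift n _ ?_ (fun k hk => ?_) (fun j hj => ?_)
  · simp [h.const_right]
  · obtain ⟨k, rfl⟩ : ∃ l, k = l + 1 := ⟨k - 1, by omega⟩
    rw [coeff_sub, coeff_add, coeff_mul_X, coeff_C_mul, h.coeff_right n _ hk]
    rcases eq_or_ne k n with rfl | hne
    · simp [h.lead_left]
    · rw [h.coeff_left _ _ (by omega), h.coeff_left n k (by omega)]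
      simp
  · rw [map_sub, map_add, pairing_C_mul, h.pairing_left_mul_X n j hj, h.orth_right n j hj,
      h.orth_left _ _ (by omega)]
    simp

lemma right_succ (n : ℕ) :
    Q (n + 1) = Q n + C ((Q (n + 1)).coeff (n + 1)) * (P n * X) := by
  rw [← sub_eq_zero]
  refine h.eq_zero_of_shift n _ ?_ (fun k hk => ?_) (fun j hj => ?_)
  · simp [h.const_right]
  · obtain ⟨k, rfl⟩ : ∃ l, k = l + 1 := ⟨k - 1, by omega⟩
    rw [coeff_sub, coeff_add, coeff_C_mul, coeff_mul_X, h.coeff_right n _ hk]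
    rcases eq_or_ne k n with rfl | hne
    · simp [h.lead_left]
    · rw [h.coeff_right _ _ (by omega), h.coeff_left n k (by omega)]
      simp
  · rw [map_sub, map_add, pairing_C_mul, h.pairing_left_mul_X n j hj, h.orth_right n j hj,
      h.orth_right _ _ (by omega)]
    simp

/-- By `left_succ`, the subleading coefficient grows by α_{n+1} β_n at each step, so the sum
telescopes. -/
lemma subleading_left (n : ℕ) :
    (P (n + 1)).coeff n
      = ∑ m ∈ Finset.Icc 1 (n + 1), (P m).coeff 0 * (Q (m - 1)).coeff (m - 1) := by
  induction n with
  | zero => simp [h.const_right]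
  | succ n ih =>
    rw [Finset.sum_Icc_succ_top (by omega), ← ih, h.left_succ (n + 1), coeff_add, coeff_mul_X,
      coeff_C_mul]
    simp [h.const_right]

variable {Wm2 Wm1 W0 : Mat N}
  (hc : ∀ j : ℤ, (j : ℂ) • c j = Wm2 * c (j + 1) + Wm1 * c j + W0 * c (j - 1))
include hc

lemma pearsonOp_right (n : ℕ) :
    pearsonOp Wm2 Wm1 W0 (Q n)
      = C ((Q n).coeff n * W0) * (P (n + 1) * X) + C Wm2 * Q (n + 1) := by
  rw [← sub_eq_zero]
  refine h.eq_zero_of_shift (n + 1) _ ?_ (fun k hk => ?_) (fun j hj => ?_)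
  · simp [h.const_right, coeff_zero_pearsonOp]
  · obtain ⟨k, rfl⟩ : ∃ l, k = l + 2 := ⟨k - 2, by omega⟩
    rw [coeff_sub, coeff_add, coeff_C_mul, coeff_mul_X, coeff_C_mul, coeff_add_two_pearsonOp,
      h.coeff_right n (k + 1) (by omega), h.coeff_right n (k + 2) (by omega),
      h.coeff_right (n + 1) (k + 2) hk]
    rcases eq_or_ne k n with rfl | hne
    · simp [h.lead_left]
    · rw [h.coeff_right _ _ (by omega), h.coeff_left (n + 1) (k + 1) (by omega)]
      simp
  · rw [map_sub, map_add, pairing_C_mul, pairing_C_mul, pairing_pearsonOp hc,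
      h.pairing_left_mul_X (n + 1) j hj, h.orth_right (n + 1) j hj]
    -- `Q n` need not be orthogonal to 1, but for j = 0 the factor produced by `pairing_pearsonOp`
    -- is zero.
    rcases j with _ | j
    · simp
    · have := h.orth_right n j (by omega)
      push_cast at this ⊢
      simp [this]

/-- The three terms on the right are chosen to match, in order, the coefficients of z^(n+3), z^(n+2)
and z^0. -/
lemma pearsonOp_left (n : ℕ) :
    pearsonOp Wm2 Wm1 W0 (P (n + 1))
      = C W0 * (P (n + 2) * X)
        + C (((n + 1 : ℕ) : Mat N) + Wm1 + (P (n + 1)).coeff n * W0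
            - W0 * (P (n + 2)).coeff (n + 1)) * (P (n + 1) * X)
        + C ((P (n + 1)).coeff 0 * Wm2) * Q (n + 1) := by
  rw [← sub_eq_zero]
  refine h.eq_zero_of_shift (n + 1) _ ?_ (fun k hk => ?_) (fun j hj => ?_)
  · simp [h.const_right, coeff_zero_pearsonOp]
  · obtain ⟨k, rfl⟩ : ∃ l, k = l + 2 := ⟨k - 2, by omega⟩
    rw [coeff_sub, coeff_add, coeff_add, coeff_C_mul, coeff_mul_X, coeff_C_mul, coeff_C_mul,
      coeff_mul_X, coeff_add_two_pearsonOp,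
      h.coeff_left (n + 1) (k + 2) (by omega), h.coeff_right (n + 1) (k + 2) hk]
    rcases eq_or_ne k n with rfl | hne
    · simp only [h.lead_left, zero_mul, mul_zero, one_mul, mul_one, zero_add, add_zero]
      abel
    · rw [h.coeff_left (n + 1) (k + 1) (by omega)]
      rcases eq_or_ne k (n + 1) with rfl | hne'
      · simp [h.lead_left]
      · rw [h.coeff_left (n + 1) k (by omega), h.coeff_left (n + 2) (k + 1) (by omega)]
        simp
  · rw [map_sub, map_add, map_add, pairing_C_mul, pairing_C_mul, pairing_C_mul,
      pairing_pearsonOp hc, h.pairing_left_mul_X (n + 2) j (by omega),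
      h.pairing_left_mul_X (n + 1) j hj, h.orth_right (n + 1) j hj]
    have := h.orth_left (n + 1) j hj
    push_cast
    simp [this]

/-- The first matrix discrete Painlevé II equation. -/
lemma painleve_left (n : ℕ) :
    (Wm1 + ((n + 1 : ℕ) : Mat N)) * (P (n + 1)).coeff 0 + W0 * (P (n + 2)).coeff 0
        - (P n).coeff 0 * Wm2
      = W0 * ((P (n + 2)).coeff 0 * (Q (n + 1)).coeff (n + 1) * (P (n + 1)).coeff 0
          + (P (n + 1)).coeff 0 * (Q n).coeff n * (P (n + 1)).coeff 0)
        + comm W0 (∑ m ∈ Finset.Icc 1 n, (P m).coeff 0 * (Q (m - 1)).coeff (m - 1))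
          * (P (n + 1)).coeff 0 := by
  -- Coefficients of z. After `hP` is substituted, subtracting α_{n+1} times `hT` from `hS` removes
  -- the unknown linear coefficients of `Q n` and `Q (n + 1)`.
  have hS := congrArg (fun R => R.coeff 1) (h.pearsonOp_left hc n)
  have hT := congrArg (fun R => R.coeff 1) (h.pearsonOp_right hc n)
  have hP := congrArg (fun R => R.coeff 1) (h.left_succ n)
  have hs1 := h.subleading_left n
  have hs2 := h.subleading_left (n + 1)
  rw [Finset.sum_Icc_succ_top (by omega)] at hs1
  rw [Finset.sum_Icc_succ_top (by omega), Finset.sum_Icc_succ_top (by omega)] at hs2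
  simp only [coeff_one_pearsonOp, coeff_add, coeff_C_mul, coeff_mul_X (n := 0),
    h.const_right, add_tsub_cancel_right, one_mul] at hS hT hP hs1 hs2
  rw [hs1, hs2, hP] at hS
  generalize (∑ m ∈ Finset.Icc 1 n, (P m).coeff 0 * (Q (m - 1)).coeff (m - 1)) = s at hS ⊢
  have hT' := congrArg (fun A => (P (n + 1)).coeff 0 * A) hT
  simp only [comm]
  simp only [mul_add, add_mul, sub_mul, ← mul_assoc] at hS hT' ⊢
  rw [← sub_eq_zero] at hS hT' ⊢
  refine Eq.trans ?_ ((congrArg₂ (fun A B => B - A) hS hT').trans (sub_zero 0))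
  abel

/-- The second matrix discrete Painlevé II equation. -/
lemma painleve_right (n : ℕ) :
    (Q (n + 1)).coeff (n + 1) * (Wm1 + ((n + 1 : ℕ) : Mat N)) + (Q n).coeff n * W0
        - Wm2 * (Q (n + 2)).coeff (n + 2)
      = ((Q (n + 1)).coeff (n + 1) * (P (n + 1)).coeff 0 * (Q n).coeff n
          + (Q (n + 1)).coeff (n + 1) * (P (n + 2)).coeff 0 * (Q (n + 1)).coeff (n + 1)) * W0
        + (Q (n + 1)).coeff (n + 1)
          * comm W0 (∑ m ∈ Finset.Icc 1 (n + 2), (P m).coeff 0 * (Q (m - 1)).coeff (m - 1)) := by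
  -- Leading coefficients. The subleading coefficient of `Q (n + 1)` enters and is expressed through
  -- `right_succ`.
  have hT := congrArg (fun R => R.coeff (n + 2)) (h.pearsonOp_right hc (n + 1))
  have hQ := congrArg (fun R => R.coeff n) (h.right_succ n)
  have hs0 : (P n * X).coeff n
      = ∑ m ∈ Finset.Icc 1 n, (P m).coeff 0 * (Q (m - 1)).coeff (m - 1) := by
    rcases n with _ | n
    · simp
    · rw [coeff_mul_X, h.subleading_left]
  have hs2 := h.subleading_left (n + 1)
  rw [Finset.sum_Icc_succ_top (by omega), Finset.sum_Icc_succ_top (by omega)] at hs2 ⊢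
  simp only [coeff_add_two_pearsonOp, coeff_add, coeff_C_mul, coeff_mul_X (n := n + 1),
    add_tsub_cancel_right, h.coeff_right (n + 1) (n + 2) (by omega), hs0] at hT hQ hs2 ⊢
  rw [hs2, hQ] at hT
  simp only [comm] at hT ⊢
  generalize (∑ m ∈ Finset.Icc 1 n, (P m).coeff 0 * (Q (m - 1)).coeff (m - 1)) = s at hT ⊢
  simp only [mul_add, add_mul, mul_sub, ← mul_assoc] at hT ⊢
  rw [← sub_eq_zero] at hT ⊢
  refine Eq.trans ?_ hT
  simp only [zero_mul]
  abel

end IsSzegoSystem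

/-! ### Circle integrals and the moment recursion -/

open Metric in
lemma circInt_congr {F G : ℂ → Mat N} (h : ∀ ζ ∈ sphere (0 : ℂ) 1, F ζ = G ζ) :
    circInt F = circInt G := by
  ext i j
  refine Real.circleAverage_congr_sphere (f₁ := fun ζ => F ζ i j) (f₂ := fun ζ => G ζ i j)
    fun ζ hζ => ?_
  rw [abs_one] at hζ
  simp only [h ζ hζ]

/-- All entries are continuous on the unit circle. -/
def ContinuousOnCircle (F : ℂ → Mat N) : Prop :=
  ∀ i j, ContinuousOn (fun ζ => F ζ i j) (Metric.sphere (0 : ℂ) 1)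

lemma circInt_sum_mul {ι : Type*} (s : Finset ι) (A : ι → Mat N) (F : ι → ℂ → Mat N)
    (hF : ∀ k ∈ s, ContinuousOnCircle (F k)) :
    circInt (fun ζ => ∑ k ∈ s, A k * F k ζ) = ∑ k ∈ s, A k * circInt (F k) := by
  ext i j
  simp only [circInt, Matrix.of_apply, Matrix.sum_apply, Matrix.mul_apply]
  have h1 : ∀ k ∈ s, ∀ l, CircleIntegrable (fun ζ => A k i l * F k ζ l j) 0 1 :=
    fun k hk l => (((hF k hk) l j).const_mul (A k i l)).circleIntegrable zero_le_one
  rw [Real.circleAverage_fun_sum (f := fun k ζ => ∑ l, A k i l * F k ζ l j)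
    (fun k hk => CircleIntegrable.fun_sum _ fun l _ => h1 k hk l)]
  refine Finset.sum_congr rfl fun k hk => ?_
  rw [Real.circleAverage_fun_sum (f := fun l ζ => A k i l * F k ζ l j) (fun l _ => h1 k hk l)]
  refine Finset.sum_congr rfl fun l _ => ?_
  exact Real.circleAverage_fun_smul (a := A k i l) (f := fun ζ => F k ζ l j)

lemma star_eq_inv_of_mem_sphere {ζ : ℂ} (h : ζ ∈ Metric.sphere (0 : ℂ) 1) : star ζ = ζ⁻¹ := by
  rw [Complex.inv_eq_conj (by simpa using h)]
  rfl

lemma ne_zero_of_mem_unitCircle {ζ : ℂ} (h : ζ ∈ Metric.sphere (0 : ℂ) 1) : ζ ≠ 0 := by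
  rintro rfl
  simp at h

lemma ContinuousOnCircle.star_zpow_smul {w : ℂ → Mat N} (hw : ContinuousOnCircle w) (j : ℤ) :
    ContinuousOnCircle (fun ζ => (star ζ) ^ j • w ζ) := by
  intro a b
  refine ContinuousOn.mul (ContinuousOn.zpow₀ (by fun_prop) j fun ζ hζ => ?_) (hw a b)
  exact Or.inl (star_ne_zero.2 (ne_zero_of_mem_unitCircle hζ))

lemma evalAt_eq_sum (P : (Mat N)[X]) (n : ℕ) (h : P.natDegree < n) (z : ℂ) :
    evalAt P z = ∑ k ∈ Finset.range n, z ^ k • P.coeff k := by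
  rw [evalAt, eval_eq_sum_range' h]
  refine Finset.sum_congr rfl fun k _ => ?_
  rw [← map_pow, Matrix.scalar_apply, ← Matrix.smul_one_eq_diagonal, mul_smul_comm, mul_one]

lemma evalAt_zero (P : (Mat N)[X]) : evalAt P 0 = P.coeff 0 := by
  rw [evalAt, map_zero, coeff_zero_eq_eval_zero]

lemma circInt_star_pow_smul_evalAt {w : ℂ → Mat N} (hw : ContinuousOnCircle w)
    (P : (Mat N)[X]) (j : ℕ) :
    circInt (fun ζ => (star ζ) ^ j • (evalAt P ζ * w ζ)) = pairing (moment w) j P := by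
  rw [pairing_eq_sum_range _ _ P (P.natDegree + 1)
    fun k hk => coeff_eq_zero_of_natDegree_lt (by omega)]
  simp only [moment]
  rw [← circInt_sum_mul _ _ _ fun k _ => hw.star_zpow_smul _]
  refine circInt_congr fun ζ hζ => ?_
  have h0 := ne_zero_of_mem_unitCircle hζ
  rw [evalAt_eq_sum P _ (Nat.lt_succ_self _), Finset.sum_mul, Finset.smul_sum]
  refine Finset.sum_congr rfl fun k _ => ?_
  rw [smul_mul_assoc, smul_smul, mul_smul_comm, star_eq_inv_of_mem_sphere hζ]
  congr 1
  rw [zpow_sub₀ (inv_ne_zero h0), zpow_natCast, zpow_natCast]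
  simp [div_eq_mul_inv]

lemma circInt_pow_smul_evalAt_conjTranspose {w : ℂ → Mat N} (hw : ContinuousOnCircle w)
    (P : (Mat N)[X]) (n : ℕ) (hn : P.natDegree < n) (j : ℕ) :
    circInt (fun ζ => ζ ^ j • ((evalAt P ζ)ᴴ * w ζ))
      = ∑ k ∈ Finset.range n, (P.coeff k)ᴴ * moment w (k - j) := by
  simp only [moment]
  rw [← circInt_sum_mul _ _ _ fun k _ => hw.star_zpow_smul _]
  refine circInt_congr fun ζ hζ => ?_
  have h0 := ne_zero_of_mem_unitCircle hζ
  rw [evalAt_eq_sum P n hn, Matrix.conjTranspose_sum, Finset.sum_mul, Finset.smul_sum]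
  refine Finset.sum_congr rfl fun k _ => ?_
  rw [Matrix.conjTranspose_smul, smul_mul_assoc, smul_smul, mul_smul_comm, star_pow,
    star_eq_inv_of_mem_sphere hζ]
  congr 1
  rw [zpow_sub₀ (inv_ne_zero h0), zpow_natCast, zpow_natCast]
  simp [div_eq_mul_inv, mul_comm]

lemma IsAnnulusWeight.continuousOnCircle {w : ℂ → Mat N} (hw : IsAnnulusWeight w) :
    ContinuousOnCircle w := fun i j =>
  (hw.1 i j).continuousOn.mono fun _ hζ => ne_zero_of_mem_unitCircle hζ

lemma IsAnnulusWeight.deriv_eq {w W : ℂ → Mat N} (hw : IsAnnulusWeight w) {z : ℂ} (hz : z ≠ 0)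
    (hW : rightLogDeriv w z = W z) (a b : Fin N) :
    deriv (fun t => w t a b) z = (W z * w z) a b := by
  rw [← hW, rightLogDeriv, Matrix.mul_assoc,
    Matrix.nonsing_inv_mul _ ((Matrix.isUnit_iff_isUnit_det _).1 (hw.2 z hz)), Matrix.mul_one]
  rfl

/-- The Pearson equation as a three-term recursion for the moments. -/
lemma moment_recursion {w : ℂ → Mat N} (hw : IsAnnulusWeight w) {Wm2 Wm1 W0 : Mat N}
    (hW : ∀ z : ℂ, z ≠ 0 → rightLogDeriv w z = laurentW Wm2 Wm1 W0 z) (j : ℤ) :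
    (j : ℂ) • moment w j
      = Wm2 * moment w (j + 1) + Wm1 * moment w j + W0 * moment w (j - 1) := by
  have hcont := hw.continuousOnCircle
  -- The four terms of ζ · d/dζ (ζ^(-j) w) = ζ^(-j) (ζ W(ζ) - j) w, with powers of ζ written through
  -- ζ̄ = ζ⁻¹. The integral of a derivative around the circle vanishes.
  let A : Fin 4 → Mat N := ![Wm2, Wm1, W0, -((j : ℂ) • 1)]
  let F : Fin 4 → ℂ → Mat N := fun k ζ => (star ζ) ^ ((![j + 1, j, j - 1, j] : Fin 4 → ℤ) k) • w ζ
  have key : circInt (fun ζ => ∑ k, A k * F k ζ) = 0 := by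
    ext a b
    have hd : ∀ z ∈ Metric.sphere (0 : ℂ) 1,
        HasDerivAt (fun t => t ^ (-j) * w t a b) ((z - 0)⁻¹ • (∑ k, A k * F k z) a b) z := by
      intro z hz
      have h0 := ne_zero_of_mem_unitCircle hz
      have hwd : HasDerivAt (fun t => w t a b) ((laurentW Wm2 Wm1 W0 z * w z) a b) z := by
        rw [← hw.deriv_eq h0 (hW z h0)]
        exact ((hw.1 a b).differentiableAt (isOpen_compl_singleton.mem_nhds h0)).hasDerivAt
      refine ((hasDerivAt_zpow (-j) z (Or.inl h0)).fun_mul hwd).congr_deriv ?_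
      simp only [Fin.sum_univ_four, A, F, laurentW, star_eq_inv_of_mem_sphere hz, add_mul,
        Matrix.add_apply, sub_zero, smul_eq_mul, Matrix.cons_val, smul_mul_assoc, mul_smul_comm,
        Matrix.smul_apply, neg_mul, Matrix.neg_apply, one_mul, _root_.inv_zpow', smul_neg]
      rw [show -(j + 1) = -j - 1 by ring, show -(j - 1) = -j + 1 by ring, zpow_sub_one₀ h0,
        zpow_add_one₀ h0]
      push_cast
      field_simp
      ring
    have h1 := circleIntegral.integral_eq_zero_of_hasDerivWithinAt zero_le_one
      fun z hz => (hd z hz).hasDerivWithinAt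
    rw [circInt, Matrix.of_apply, Real.circleAverage_eq_circleIntegral one_ne_zero, h1, smul_zero,
      Matrix.zero_apply]
  rw [circInt_sum_mul _ _ _ fun k _ => hcont.star_zpow_smul _] at key
  simp only [Fin.sum_univ_four, A, Matrix.cons_val, neg_mul, smul_mul_assoc, one_mul] at key
  exact (eq_of_sub_eq_zero ((sub_eq_add_neg _ _).trans key)).symm

/-! ### Existence of the Szegő polynomials -/

/-- Unknown blocks multiply from the left, so the block system splits into one row-vector system for
each matrix row i. -/
lemma block_sum_apply {n : ℕ} (D : Fin n → Fin n → Mat N) (x : Fin n → Mat N) (j : Fin n)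
    (i b : Fin N) :
    (∑ k, x k * D k j) i b
      = ((fun p : Fin n × Fin N => x p.1 i p.2) ᵥ*
          (Matrix.of fun p q : Fin n × Fin N => D p.1 q.1 p.2 q.2)) (j, b) := by
  simp [Matrix.sum_apply, Matrix.mul_apply, Matrix.vecMul, dotProduct, Fintype.sum_prod_type]

lemma exists_block_solution {n : ℕ} (D : Fin n → Fin n → Mat N)
    (hD : (Matrix.of fun p q : Fin n × Fin N => D p.1 q.1 p.2 q.2).det ≠ 0)
    (r : Fin n → Mat N) : ∃ x : Fin n → Mat N, ∀ j, ∑ k, x k * D k j = r j := by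
  set M := Matrix.of fun p q : Fin n × Fin N => D p.1 q.1 p.2 q.2 with hM
  refine ⟨fun k => Matrix.of fun i a =>
    ((fun q : Fin n × Fin N => r q.1 i q.2) ᵥ* M⁻¹) (k, a), fun j => ?_⟩
  ext i b
  rw [block_sum_apply, ← hM]
  simp only [Matrix.of_apply, Prod.mk.eta]
  rw [Matrix.vecMul_vecMul, Matrix.nonsing_inv_mul _ (isUnit_iff_ne_zero.2 hD), Matrix.vecMul_one]

lemma block_solution_eq_zero {n : ℕ} (D : Fin n → Fin n → Mat N)
    (hD : (Matrix.of fun p q : Fin n × Fin N => D p.1 q.1 p.2 q.2).det ≠ 0)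
    (x : Fin n → Mat N) (hx : ∀ j, ∑ k, x k * D k j = 0) : x = 0 := by
  ext k i a
  have := Matrix.eq_zero_of_vecMul_eq_zero hD (v := fun p : Fin n × Fin N => x p.1 i p.2) (by
    ext ⟨j, b⟩
    rw [← block_sum_apply, hx]
    rfl)
  exact congrFun this (k, a)

lemma QuasiDefinite.det_momentL_ne_zero {w : ℂ → Mat N} (h : QuasiDefinite w) (n : ℕ) :
    (momentL w n).det ≠ 0 := by
  rcases n with _ | n
  · simp
  · exact (h _ (by omega)).1

lemma QuasiDefinite.det_momentR_ne_zero {w : ℂ → Mat N} (h : QuasiDefinite w) (n : ℕ) :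
    (momentR w n).det ≠ 0 := by
  rcases n with _ | n
  · simp
  · exact (h _ (by omega)).2

lemma QuasiDefinite.nondegenerate {w : ℂ → Mat N} (h : QuasiDefinite w) (n : ℕ) (R : (Mat N)[X])
    (hd : ∀ k, n ≤ k → R.coeff k = 0)
    (ho : ∀ j : ℕ, j < n → pairing (moment w) j R = 0) : R = 0 := by
  have := block_solution_eq_zero (fun k j : Fin n => moment w ((j : ℤ) - k))
    (h.det_momentR_ne_zero n) (fun k => R.coeff k) fun j => by
      rw [← ho j j.2, pairing_eq_sum_range _ _ R n hd, ← Fin.sum_univ_eq_sum_range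
        (fun k => R.coeff k * moment w (j - k)) n]
  ext1 k
  by_cases hk : k < n
  · exact congrFun this ⟨k, hk⟩
  · exact hd k (by omega)

/-- A monic polynomial of degree `n` with prescribed lower coefficients. -/
lemma exists_monicOfDegree {n : ℕ} (x : Fin n → Mat N) :
    ∃ P : (Mat N)[X], MonicOfDegree P n ∧ ∀ k : Fin n, P.coeff k = x k := by
  let P : (Mat N)[X] := monomial n 1 + ∑ k : Fin n, monomial (k : ℕ) (x k)
  have hc (m : ℕ) : P.coeff m
      = (if n = m then 1 else 0) + ∑ k : Fin n, if (k : ℕ) = m then x k else 0 := by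
    simp [P, coeff_monomial]
  refine ⟨P, ⟨natDegree_le_iff_coeff_eq_zero.2 fun m hm => ?_, ?_⟩, fun k => ?_⟩
  · rw [hc, if_neg (by omega), Finset.sum_eq_zero fun k _ => if_neg (by omega), add_zero]
  · rw [hc, if_pos rfl, Finset.sum_eq_zero fun k _ => if_neg (by omega), add_zero]
  · rw [hc, if_neg (by omega), zero_add]
    simp [Fin.val_inj]

lemma isSzegoL1_iff {w : ℂ → Mat N} (hw : ContinuousOnCircle w) (n : ℕ) (P : (Mat N)[X]) :
    IsSzegoL1 w n P ↔ MonicOfDegree P n ∧ ∀ j : ℕ, j < n → pairing (moment w) j P = 0 := by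
  simp only [IsSzegoL1, circInt_star_pow_smul_evalAt hw]

lemma isSzegoR2_iff {w : ℂ → Mat N} (hw : ContinuousOnCircle w) (n : ℕ) (P : (Mat N)[X]) :
    IsSzegoR2 w n P ↔ MonicOfDegree P n ∧ ∀ j : ℕ, j < n →
      ∑ k ∈ Finset.range (n + 1), (P.coeff k)ᴴ * moment w (k - j) = 0 := by
  refine and_congr_right fun h => forall₂_congr fun j _ => ?_
  rw [circInt_pow_smul_evalAt_conjTranspose hw P (n + 1) (Nat.lt_succ_of_le h.1)]

lemma isSzegoL1_szegoL1 {w : ℂ → Mat N} (hw : ContinuousOnCircle w) (h : QuasiDefinite w)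
    (n : ℕ) : IsSzegoL1 w n (szegoL1 w n) := by
  refine Classical.epsilon_spec (p := IsSzegoL1 w n) ?_
  obtain ⟨x, hx⟩ := exists_block_solution (fun k j : Fin n => moment w ((j : ℤ) - k))
    (h.det_momentR_ne_zero n) (fun j => -moment w ((j : ℤ) - n))
  obtain ⟨P, hP, hPx⟩ := exists_monicOfDegree x
  refine ⟨P, (isSzegoL1_iff hw n P).2 ⟨hP, fun j hj => ?_⟩⟩
  rw [pairing_eq_sum_range _ _ P (n + 1) fun k hk =>
    coeff_eq_zero_of_natDegree_lt (hP.1.trans_lt hk), Finset.sum_range_succ, hP.2, one_mul,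
    ← Fin.sum_univ_eq_sum_range (fun k => P.coeff k * moment w (j - k)) n]
  simp only [hPx]
  rw [hx ⟨j, hj⟩, neg_add_cancel]

lemma isSzegoR2_szegoR2 {w : ℂ → Mat N} (hw : ContinuousOnCircle w) (h : QuasiDefinite w)
    (n : ℕ) : IsSzegoR2 w n (szegoR2 w n) := by
  refine Classical.epsilon_spec (p := IsSzegoR2 w n) ?_
  obtain ⟨x, hx⟩ := exists_block_solution (fun k j : Fin n => moment w ((k : ℤ) - j))
    (h.det_momentL_ne_zero n) (fun j => -moment w ((n : ℤ) - j))
  obtain ⟨P, hP, hPx⟩ := exists_monicOfDegree fun k => (x k)ᴴ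
  refine ⟨P, (isSzegoR2_iff hw n P).2 ⟨hP, fun j hj => ?_⟩⟩
  rw [Finset.sum_range_succ, hP.2, Matrix.conjTranspose_one, one_mul,
    ← Fin.sum_univ_eq_sum_range (fun k => (P.coeff k)ᴴ * moment w (k - j)) n]
  simp only [hPx, Matrix.conjTranspose_conjTranspose]
  rw [hx ⟨j, hj⟩, neg_add_cancel]

/-! ### Reversal and the passage to biorthogonal systems -/

/-- The reversed polynomial `zⁿ (P (1 / z̄))ᴴ`. -/
def reversed (n : ℕ) (P : (Mat N)[X]) : (Mat N)[X] :=
  ∑ k ∈ Finset.range (n + 1), monomial (n - k) (P.coeff k)ᴴ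

lemma coeff_reversed_of_le {n k : ℕ} (hk : k ≤ n) (P : (Mat N)[X]) :
    (reversed n P).coeff k = (P.coeff (n - k))ᴴ := by
  rw [reversed, finsetSum_coeff, Finset.sum_eq_single (n - k)]
  · rw [coeff_monomial, if_pos (by omega)]
  · intro l hl hne
    rw [Finset.mem_range] at hl
    rw [coeff_monomial, if_neg (by omega)]
  · intro hl
    exact absurd (Finset.mem_range.2 (by omega)) hl

lemma coeff_reversed_of_lt {n k : ℕ} (hk : n < k) (P : (Mat N)[X]) :
    (reversed n P).coeff k = 0 := by
  rw [reversed, finsetSum_coeff]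
  exact Finset.sum_eq_zero fun l _ => by rw [coeff_monomial, if_neg (by omega)]

lemma pairing_reversed (c : ℤ → Mat N) (m : ℤ) (n : ℕ) (P : (Mat N)[X]) :
    pairing c m (reversed n P)
      = ∑ k ∈ Finset.range (n + 1), (P.coeff k)ᴴ * c (k - (n - m)) := by
  rw [reversed, map_sum]
  refine Finset.sum_congr rfl fun k hk => ?_
  rw [pairing_monomial, Nat.cast_sub (Nat.lt_succ_iff.1 (Finset.mem_range.1 hk))]
  congr 2
  ring

theorem isSzegoSystem {w : ℂ → Mat N} (hw : ContinuousOnCircle w) (h : QuasiDefinite w) :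
    IsSzegoSystem (moment w) (szegoL1 w) (fun n => reversed n (szegoR2 w n)) where
  nondegenerate := h.nondegenerate
  coeff_left n k hk := coeff_eq_zero_of_natDegree_lt
    ((isSzegoL1_szegoL1 hw h n).1.1.trans_lt hk)
  lead_left n := (isSzegoL1_szegoL1 hw h n).1.2
  orth_left n := ((isSzegoL1_iff hw n _).1 (isSzegoL1_szegoL1 hw h n)).2
  coeff_right n k hk := coeff_reversed_of_lt hk _
  const_right n := by
    rw [coeff_reversed_of_le (Nat.zero_le n), Nat.sub_zero, (isSzegoR2_szegoR2 hw h n).1.2,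
      Matrix.conjTranspose_one]
  orth_right n j hj := by
    -- Reversal carries orthogonality at index j + 1 to the right condition at index n - (j + 1).
    rw [pairing_reversed, ← ((isSzegoR2_iff hw n _).1 (isSzegoR2_szegoR2 hw h n)).2 (n - 1 - j)
      (by omega)]
    refine Finset.sum_congr rfl fun k _ => ?_
    congr 2
    omega

theorem painleve_of_quasiDefinite {Wm2 Wm1 W0 : Mat N} {w : ℂ → Mat N} (hw : IsAnnulusWeight w)
    (hW : ∀ z : ℂ, z ≠ 0 → rightLogDeriv w z = laurentW Wm2 Wm1 W0 z) (h : QuasiDefinite w)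
    (α β : ℕ → Mat N) (hα : ∀ n, α n = verblunskyL1 w n) (hβ : ∀ n, β n = (verblunskyR2 w n)ᴴ)
    (n : ℕ) (hn : 1 ≤ n) :
    ((Wm1 + (n : ℂ) • 1) * α n + W0 * α (n + 1) - α (n - 1) * Wm2
        = W0 * (α (n + 1) * β n * α n + α n * β (n - 1) * α n)
          + comm W0 (∑ m ∈ Finset.Icc 1 (n - 1), α m * β (m - 1)) * α n) ∧
      (β n * (Wm1 + (n : ℂ) • 1) + β (n - 1) * W0 - Wm2 * β (n + 1)
        = (β n * α n * β (n - 1) + β n * α (n + 1) * β n) * W0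
          + β n * comm W0 (∑ m ∈ Finset.Icc 1 (n + 1), α m * β (m - 1))) := by
  obtain ⟨n, rfl⟩ : ∃ l, n = l + 1 := ⟨n - 1, by omega⟩
  have hsys := isSzegoSystem hw.continuousOnCircle h
  have hα' : ∀ n, (szegoL1 w n).coeff 0 = α n := fun n => by rw [hα, verblunskyL1, evalAt_zero]
  have hβ' : ∀ n, (reversed n (szegoR2 w n)).coeff n = β n := fun n => by
    rw [hβ, verblunskyR2, evalAt_zero, coeff_reversed_of_le le_rfl, Nat.sub_self]
  have hcast : ((n + 1 : ℕ) : ℂ) • (1 : Mat N) = ((n + 1 : ℕ) : Mat N) := by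
    rw [Nat.cast_smul_eq_nsmul, nsmul_one]
  have h1 := hsys.painleve_left (moment_recursion hw hW) n
  have h2 := hsys.painleve_right (moment_recursion hw hW) n
  simp only [hα', hβ'] at h1 h2
  rw [hcast]
  exact ⟨h1, h2⟩

/-- If αβ = 1, the two Szegő recursions make `P (n + 1)` equal to α `Q (n + 1)`. It is then
orthogonal to ζ^(n+1) as well, hence zero, although it is monic. -/
lemma IsSzegoSystem.verblunsky_mul_ne_one [NeZero N] {c : ℤ → Mat N} {P Q : ℕ → (Mat N)[X]}
    (h : IsSzegoSystem c P Q) (n : ℕ) :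
    (P (n + 1)).coeff 0 * (Q (n + 1)).coeff (n + 1) ≠ 1 := by
  intro h1
  have hPQ : P (n + 1) = C ((P (n + 1)).coeff 0) * Q (n + 1) := by
    conv_rhs => rw [h.right_succ n, mul_add, ← mul_assoc, ← C_mul, h1, C_1, one_mul, add_comm]
    exact h.left_succ n
  have h0 : P (n + 1) = 0 := by
    refine h.nondegenerate (n + 2) _ (fun k hk => h.coeff_left _ _ (by omega)) fun j hj => ?_
    rcases eq_or_ne j (n + 1) with rfl | hne
    · rw [hPQ, pairing_C_mul, h.orth_right (n + 1) n (by omega), mul_zero]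
    · exact h.orth_left _ _ (by omega)
  have := h.lead_left (n + 1)
  rw [h0, coeff_zero] at this
  exact zero_ne_one this

lemma IsSzegoL1.unique {w : ℂ → Mat N} (hw : ContinuousOnCircle w) (h : QuasiDefinite w) {n : ℕ}
    {P R : (Mat N)[X]} (hP : IsSzegoL1 w n P) (hR : IsSzegoL1 w n R) : P = R := by
  rw [isSzegoL1_iff hw] at hP hR
  rw [← sub_eq_zero]
  refine h.nondegenerate n _ (fun k hk => ?_) fun j hj => ?_
  · rcases hk.eq_or_lt with rfl | hk
    · rw [coeff_sub, hP.1.2, hR.1.2, sub_self]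
    · rw [coeff_sub, coeff_eq_zero_of_natDegree_lt (hP.1.1.trans_lt hk),
        coeff_eq_zero_of_natDegree_lt (hR.1.1.trans_lt hk), sub_self]
  · rw [map_sub, hP.2 j hj, hR.2 j hj, sub_self]

/-! ### The scalar weight and its quasi-definiteness -/

/-- The Fourier coefficients of the real weight `exp (2 k cos θ)`, i.e. modified Bessel
functions. -/
def besselMoment (k : ℝ) (j : ℤ) : ℂ :=
  Real.circleAverage (fun ζ => (star ζ) ^ j * (Real.exp (2 * k * ζ.re) : ℂ)) 0 1

lemma circleIntegrable_besselMoment (k : ℝ) (j : ℤ) :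
    CircleIntegrable (fun ζ => (star ζ) ^ j * (Real.exp (2 * k * ζ.re) : ℂ)) 0 1 := by
  refine ContinuousOn.circleIntegrable zero_le_one (ContinuousOn.mul
    (ContinuousOn.zpow₀ (by fun_prop) j fun ζ hζ => ?_) (by fun_prop))
  exact Or.inl (star_ne_zero.2 (ne_zero_of_mem_unitCircle hζ))

/-- The substitution ζ ↦ ζ⁻¹ = ζ̄ preserves both the measure and Re ζ. -/
lemma besselMoment_neg (k : ℝ) (j : ℤ) : besselMoment k (-j) = besselMoment k j := by
  rw [besselMoment, ← Real.circleAverage_zero_one_congr_inv]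
  refine Real.circleAverage_congr_sphere (f₁ := fun ζ : ℂ => _) (f₂ := fun ζ : ℂ => _)
    fun ζ hζ => ?_
  rw [abs_one] at hζ
  have h : ζ⁻¹ = star ζ := (star_eq_inv_of_mem_sphere hζ).symm
  simp only [star_inv₀, _root_.inv_zpow', neg_neg]
  rw [h]
  rfl

lemma star_besselMoment (k : ℝ) (j : ℤ) : star (besselMoment k j) = besselMoment k j := by
  rw [← besselMoment_neg]
  conv_rhs => rw [besselMoment_neg]
  simp only [besselMoment]
  have := Complex.conjCLE.toContinuousLinearMap.circleAverage_comp_comm (c := 0) (R := 1)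
    (f := fun ζ => (star ζ) ^ (-j) * (Real.exp (2 * k * ζ.re) : ℂ)) ?_
  · refine this.symm.trans ?_
    refine Real.circleAverage_congr_sphere (f₁ := fun ζ : ℂ => _) (f₂ := fun ζ : ℂ => _)
      fun ζ hζ => ?_
    rw [abs_one] at hζ
    have h : ζ⁻¹ = star ζ := (star_eq_inv_of_mem_sphere hζ).symm
    refine (map_mul (starRingEnd ℂ) _ _).trans ?_
    rw [Complex.conj_ofReal, map_zpow₀, ← Complex.star_def, star_star, ← _root_.inv_zpow', h]
  · exact circleIntegrable_besselMoment k (-j)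

/-- The quotient of w by exp(k(z + 1/z)) has zero derivative on the connected punctured plane;
invertibility of w at 1 excludes C = 0. -/
lemma exists_weight_eq {k : ℝ} {w : ℂ → Mat 1} (hw : IsAnnulusWeight w)
    (hW : ∀ z : ℂ, z ≠ 0 →
      rightLogDeriv w z = laurentW (-((k : ℂ) • 1)) 0 ((k : ℂ) • 1) z) :
    ∃ C : ℂ, C ≠ 0 ∧ ∀ z, z ≠ 0 → w z 0 0 = C * Complex.exp (k * (z + z⁻¹)) := by
  have hd (z : ℂ) (hz : z ∈ ({0}ᶜ : Set ℂ)) :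
      HasDerivAt (fun z => w z 0 0 * Complex.exp (-(k * (z + z⁻¹)))) 0 z := by
    have hz : z ≠ 0 := hz
    have hwd : HasDerivAt (fun t => w t 0 0) ((k - k * (z ^ 2)⁻¹) * w z 0 0) z := by
      have h1 := hw.deriv_eq hz (hW z hz) 0 0
      have h2 : ((laurentW (-((k : ℂ) • 1)) 0 ((k : ℂ) • 1) z * w z : Mat 1) 0 0 : ℂ)
          = (k - k * (z ^ 2)⁻¹) * w z 0 0 := by
        simp only [laurentW, Matrix.mul_apply, Finset.univ_unique, Finset.sum_singleton,
          Fin.default_eq_zero, Matrix.add_apply, Matrix.smul_apply, Matrix.neg_apply,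
          Matrix.one_apply_eq, Matrix.zero_apply, smul_eq_mul]
        ring
      rw [← h2, ← h1]
      exact ((hw.1 0 0).differentiableAt (isOpen_compl_singleton.mem_nhds hz)).hasDerivAt
    refine (hwd.fun_mul ((((hasDerivAt_id' z).fun_add (hasDerivAt_inv hz)).const_mul
      (k : ℂ)).fun_neg.cexp)).congr_deriv ?_
    ring
  have hconn : IsPreconnected ({0}ᶜ : Set ℂ) :=
    (isConnected_compl_singleton_of_one_lt_rank (by simp) (0 : ℂ)).isPreconnected
  obtain ⟨C, hC⟩ := isOpen_compl_singleton.exists_is_const_of_deriv_eq_zero hconn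
    (fun z hz => (hd z hz).differentiableAt.differentiableWithinAt) (fun z hz => (hd z hz).deriv)
  have hwC : ∀ z, z ≠ 0 → w z 0 0 = C * Complex.exp (k * (z + z⁻¹)) := fun z hz => by
    rw [← hC z hz, mul_assoc, ← Complex.exp_add, neg_add_cancel, Complex.exp_zero, mul_one]
  refine ⟨C, ?_, hwC⟩
  rintro rfl
  have h1 := (Matrix.isUnit_iff_isUnit_det _).1 (hw.2 1 one_ne_zero)
  simp [hwC 1 one_ne_zero] at h1

lemma moment_eq_besselMoment {k : ℝ} {w : ℂ → Mat 1} {C : ℂ}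
    (hwC : ∀ z, z ≠ 0 → w z 0 0 = C * Complex.exp (k * (z + z⁻¹))) (j : ℤ) :
    moment w j = (C * besselMoment k j) • 1 := by
  ext a b
  rw [Subsingleton.elim a 0, Subsingleton.elim b 0, moment, circInt, Matrix.of_apply, besselMoment,
    ← smul_eq_mul C, ← Real.circleAverage_fun_smul]
  simp only [Matrix.smul_apply, Matrix.one_apply_eq, smul_eq_mul, mul_one]
  refine Real.circleAverage_congr_sphere (f₁ := fun ζ : ℂ => _) (f₂ := fun ζ : ℂ => _)
    fun ζ hζ => ?_
  rw [abs_one] at hζ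
  simp only []
  rw [hwC ζ (ne_zero_of_mem_unitCircle hζ), ← star_eq_inv_of_mem_sphere hζ]
  have : ζ + star ζ = (2 * ζ.re : ℝ) := Complex.add_conj ζ
  rw [this]
  push_cast
  ring_nf

lemma sum_besselMoment (k : ℝ) {n : ℕ} (v : Fin n → ℂ) :
    ∑ j : Fin n, star (v j) * ∑ l : Fin n, v l * besselMoment k ((j : ℤ) - l)
      = Real.circleAverage (fun ζ =>
          Complex.normSq (∑ l : Fin n, v l * ζ ^ (l : ℕ)) * Real.exp (2 * k * ζ.re)) 0 1 := by
  have hcast := Complex.ofRealCLM.circleAverage_comp_comm (c := 0) (R := 1)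
    (f := fun ζ => Complex.normSq (∑ l : Fin n, v l * ζ ^ (l : ℕ)) * Real.exp (2 * k * ζ.re))
    (ContinuousOn.circleIntegrable zero_le_one (by
      have := Complex.continuous_normSq
      fun_prop))
  refine Eq.trans ?_ hcast
  have hterm (j l : Fin n) : star (v j) * (v l * besselMoment k ((j : ℤ) - l))
      = Real.circleAverage (fun ζ => (star (v j) * v l) •
          ((star ζ) ^ ((j : ℤ) - l) * (Real.exp (2 * k * ζ.re) : ℂ))) 0 1 := by
    rw [Real.circleAverage_fun_smul, smul_eq_mul, mul_assoc, besselMoment]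
  have hint (j l : Fin n) : CircleIntegrable (fun ζ => (star (v j) * v l) •
      ((star ζ) ^ ((j : ℤ) - l) * (Real.exp (2 * k * ζ.re) : ℂ))) 0 1 :=
    CircleIntegrable.const_fun_smul (circleIntegrable_besselMoment k _)
  simp only [Finset.mul_sum, hterm]
  simp only [← Real.circleAverage_fun_sum fun l _ => hint _ l]
  rw [← Real.circleAverage_fun_sum fun j _ => CircleIntegrable.fun_sum _ fun l _ => hint j l]
  refine Real.circleAverage_congr_sphere (f₁ := fun ζ : ℂ => _) (f₂ := fun ζ : ℂ => _)
    fun ζ hζ => ?_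
  rw [abs_one] at hζ
  have h0 := ne_zero_of_mem_unitCircle hζ
  simp only [Function.comp_apply, Complex.ofRealCLM_apply, Complex.ofReal_mul,
    Complex.normSq_eq_conj_mul_self, map_sum, map_mul, map_pow]
  rw [Finset.sum_mul_sum, Finset.sum_mul]
  simp only [Finset.sum_mul]
  refine Finset.sum_congr rfl fun j _ => Finset.sum_congr rfl fun l _ => ?_
  have h1 : (starRingEnd ℂ) ζ = ζ⁻¹ := star_eq_inv_of_mem_sphere hζ
  rw [h1, star_eq_inv_of_mem_sphere hζ, zpow_sub₀ (inv_ne_zero h0), zpow_natCast, zpow_natCast]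
  simp [div_eq_mul_inv]
  ring

/-- The Toeplitz form is the mean of |p|² against a positive continuous weight, p having
coefficients v. If it vanishes, p is zero on the whole circle, an infinite set. -/
lemma eq_zero_of_sum_besselMoment (k : ℝ) {n : ℕ} (v : Fin n → ℂ)
    (hv : ∀ j : Fin n, ∑ l : Fin n, v l * besselMoment k ((j : ℤ) - l) = 0) : v = 0 := by
  have h0 := sum_besselMoment k v
  simp only [hv, mul_zero, Finset.sum_const_zero] at h0
  have h0 := (Complex.ofReal_eq_zero.1 h0.symm)
  rw [Real.circleAverage_def, smul_eq_mul, mul_eq_zero, or_iff_right (by positivity)] at h0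
  have hroot : ∀ ζ ∈ Metric.sphere (0 : ℂ) 1, ∑ l : Fin n, v l * ζ ^ (l : ℕ) = 0 := by
    intro ζ hζ
    by_contra hne
    obtain ⟨θ, hθ, rfl⟩ : ∃ θ ∈ Set.Icc (0 : ℝ) (2 * Real.pi), circleMap 0 1 θ = ζ := by
      have h1 := image_circleMap_Ioc 0 1
      rw [abs_one] at h1
      obtain ⟨θ, hθ, rfl⟩ := h1.symm.subset hζ
      exact ⟨θ, Set.Ioc_subset_Icc_self hθ, rfl⟩
    refine (intervalIntegral.integral_pos Real.two_pi_pos (Continuous.continuousOn ?_)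
      (fun θ _ => ?_) ⟨θ, hθ, ?_⟩).ne' h0
    · have := continuous_circleMap 0 1
      fun_prop
    · exact mul_nonneg (Complex.normSq_nonneg _) (Real.exp_pos _).le
    · exact mul_pos (Complex.normSq_pos.2 hne) (Real.exp_pos _)
  let p : ℂ[X] := ∑ l : Fin n, monomial (l : ℕ) (v l)
  have hp : p = 0 := by
    refine Polynomial.eq_zero_of_infinite_isRoot p (Set.Infinite.mono (s := Metric.sphere 0 1) ?_ ?_)
    · intro ζ hζ
      simpa [p, IsRoot, eval_finsetSum] using hroot ζ hζ
    · refine (isPreconnected_sphere (by simp) 0 1).infinite_of_nontrivial ⟨1, by simp, -1, by simp, ?_⟩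
      norm_num
  ext l
  have := congrArg (fun q => q.coeff (l : ℕ)) hp
  simpa [p, coeff_monomial, Fin.val_inj] using this

lemma quasiDefinite_of_moment_eq {k : ℝ} {w : ℂ → Mat 1} {C : ℂ} (hC : C ≠ 0)
    (hm : ∀ j, moment w j = (C * besselMoment k j) • 1) : QuasiDefinite w := by
  intro n _
  have hLR : momentL w n = momentR w n := by
    ext p q
    simp only [momentL, momentR, Matrix.of_apply, hm]
    rw [← besselMoment_neg, neg_sub]
  rw [hLR, and_self]
  intro hdet
  obtain ⟨v, hv0, hv⟩ := Matrix.exists_vecMul_eq_zero_iff.2 hdet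
  refine hv0 ?_
  have := eq_zero_of_sum_besselMoment k (fun l : Fin n => v (l, 0)) fun j => by
    have h1 := congrFun hv (j, 0)
    simp only [Matrix.vecMul, dotProduct, Fintype.sum_prod_type, momentR, Matrix.of_apply, hm,
      Finset.univ_unique, Finset.sum_singleton, Matrix.smul_apply, Fin.default_eq_zero,
      Matrix.one_apply_eq, smul_eq_mul, mul_one, Pi.zero_apply] at h1
    refine (mul_eq_zero.1 (?_ : C * _ = 0)).resolve_left hC
    rw [← h1, Finset.mul_sum]
    exact Finset.sum_congr rfl fun l _ => by ring
  ext ⟨l, a⟩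
  rw [Subsingleton.elim a 0]
  exact congrFun this l

/-! ### Conjugation symmetry and the scalar Painlevé equation -/

/-- Entrywise complex conjugation of matrices. -/
def conjMat (N : ℕ) : Mat N →+* Mat N := (starRingEnd ℂ).mapMatrix

lemma conjMat_smul (z : ℂ) (A : Mat N) : conjMat N (z • A) = star z • conjMat N A := by
  ext i j
  simp [conjMat]

lemma conjMat_conjMat (A : Mat N) : conjMat N (conjMat N A) = A := by
  ext i j
  simp [conjMat]

lemma conjMat_eq_conjTranspose (A : Mat 1) : conjMat 1 A = Aᴴ := by
  ext i j
  rw [Subsingleton.elim i j]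
  simp [conjMat]

lemma MonicOfDegree.map_conjMat {P : (Mat N)[X]} {n : ℕ} (h : MonicOfDegree P n) :
    MonicOfDegree (P.map (conjMat N)) n :=
  ⟨natDegree_map_le.trans h.1, by rw [coeff_map, h.2, map_one]⟩

lemma MonicOfDegree.pairing_eq {P : (Mat N)[X]} {n : ℕ} (h : MonicOfDegree P n) (c : ℤ → Mat N)
    (m : ℤ) : pairing c m P = ∑ k ∈ Finset.range (n + 1), P.coeff k * c (m - k) :=
  pairing_eq_sum_range _ _ P (n + 1) fun _ hk => coeff_eq_zero_of_natDegree_lt (h.1.trans_lt hk)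

section Scalar

variable {k : ℝ} {w : ℂ → Mat 1} {K : ℂ} (hw : ContinuousOnCircle w) (hK : K ≠ 0)
  (hm : ∀ j, moment w j = (K * besselMoment k j) • 1)
include hw hK hm

lemma map_conjMat_szegoL1 (n : ℕ) : (szegoL1 w n).map (conjMat 1) = szegoL1 w n := by
  have hq := quasiDefinite_of_moment_eq hK hm
  have hP := isSzegoL1_szegoL1 hw hq n
  refine IsSzegoL1.unique hw hq ?_ hP
  rw [isSzegoL1_iff hw] at hP ⊢
  refine ⟨hP.1.map_conjMat, fun j hj => ?_⟩
  -- Only the constant K may fail to be real, so conjugation multiplies all moments by one common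
  -- factor and preserves the orthogonality conditions.
  have hc (i : ℤ) : moment w i = (K * (star K)⁻¹) • conjMat 1 (moment w i) := by
    rw [hm, conjMat_smul, star_mul', star_besselMoment, map_one, smul_smul]
    congr 1
    have := star_ne_zero.2 hK
    field_simp
  rw [hP.1.map_conjMat.pairing_eq]
  have h0 := hP.2 j hj
  rw [hP.1.pairing_eq] at h0
  have h1 := congrArg (fun A => (K * (star K)⁻¹) • conjMat 1 A) h0
  simp only [map_sum, map_mul, Finset.smul_sum, map_zero, smul_zero] at h1
  rw [← h1]
  refine Finset.sum_congr rfl fun l _ => ?_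
  rw [coeff_map, ← mul_smul_comm, ← hc]

/-- Since the moments are even in the index, conjugating the right conditions gives the left ones;
reality of the left polynomial then removes the conjugation. -/
lemma szegoR2_eq_szegoL1 (n : ℕ) : szegoR2 w n = szegoL1 w n := by
  have hq := quasiDefinite_of_moment_eq hK hm
  have hP := isSzegoR2_szegoR2 hw hq n
  have h1 : (szegoR2 w n).map (conjMat 1) = szegoL1 w n := by
    refine IsSzegoL1.unique hw hq ?_ (isSzegoL1_szegoL1 hw hq n)
    rw [isSzegoR2_iff hw] at hP
    rw [isSzegoL1_iff hw]
    refine ⟨hP.1.map_conjMat, fun j hj => ?_⟩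
    rw [hP.1.map_conjMat.pairing_eq, ← hP.2 j hj]
    refine Finset.sum_congr rfl fun l _ => ?_
    rw [coeff_map, conjMat_eq_conjTranspose, hm, hm, ← besselMoment_neg, neg_sub]
  rw [← map_conjMat_szegoL1 hw hK hm, ← h1]
  ext1 l
  simp only [coeff_map, conjMat_conjMat]

lemma verblunskyL1_eq_real (n : ℕ) :
    verblunskyL1 w n = (((verblunskyL1 w n 0 0).re : ℝ) : ℂ) • 1 := by
  have h1 := congrArg (fun P => P.coeff 0 0 0) (map_conjMat_szegoL1 hw hK hm n)
  have h2 := (Complex.conj_eq_iff_re (z := verblunskyL1 w n 0 0)).1 (by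
    simpa [conjMat, verblunskyL1, evalAt_zero] using h1)
  ext a b
  rw [Subsingleton.elim a 0, Subsingleton.elim b 0, h2]
  simp

end Scalar

theorem scalar_reduction {k : ℝ} {w : ℂ → Mat 1} (hw : IsAnnulusWeight w)
    (hW : ∀ z : ℂ, z ≠ 0 →
      rightLogDeriv w z = laurentW (-((k : ℂ) • 1)) 0 ((k : ℂ) • 1) z) :
    QuasiDefinite w ∧ ∃ a : ℕ → ℝ,
      (∀ n, verblunskyL1 w n = (a n : ℂ) • 1) ∧
      (∀ n, verblunskyR2 w n = (a n : ℂ) • 1) ∧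
      ∀ n : ℕ, 1 ≤ n →
        1 - a n ^ 2 ≠ 0 ∧
        (n : ℝ) * (a n / (1 - a n ^ 2)) + k * (a (n + 1) + a (n - 1)) = 0 := by
  obtain ⟨K, hK, hwK⟩ := exists_weight_eq hw hW
  have hm := moment_eq_besselMoment hwK
  have hq := quasiDefinite_of_moment_eq hK hm
  have hc := hw.continuousOnCircle
  have hL := verblunskyL1_eq_real hc hK hm
  generalize ha : (fun n => (verblunskyL1 w n 0 0).re) = a at *
  replace hL : ∀ n, verblunskyL1 w n = (a n : ℂ) • 1 := fun n => by
    rw [← ha]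
    exact hL n
  have hR : ∀ n, verblunskyR2 w n = (a n : ℂ) • 1 := fun n => by
    rw [← hL, verblunskyR2, szegoR2_eq_szegoL1 hc hK hm, verblunskyL1]
  refine ⟨hq, a, hL, hR, fun n hn => ?_⟩
  have hne : 1 - a n ^ 2 ≠ 0 := by
    obtain ⟨n, rfl⟩ : ∃ l, n = l + 1 := ⟨n - 1, by omega⟩
    intro h0
    apply (isSzegoSystem hc hq).verblunsky_mul_ne_one n
    have h1 := hL (n + 1)
    have h2 := hR (n + 1)
    rw [verblunskyL1, evalAt_zero] at h1
    rw [verblunskyR2, evalAt_zero] at h2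
    rw [coeff_reversed_of_le le_rfl, Nat.sub_self, h1, h2, Matrix.conjTranspose_smul,
      Matrix.conjTranspose_one, smul_mul_smul_comm, mul_one]
    have h3 : (a (n + 1) : ℂ) * star (a (n + 1) : ℂ) = 1 := by
      rw [Complex.star_def, Complex.conj_ofReal, ← Complex.ofReal_mul, ← Complex.ofReal_one]
      congr 1
      linarith
    rw [h3, one_smul]
  refine ⟨hne, ?_⟩
  have h1 := (painleve_of_quasiDefinite hw hW hq (fun n => (a n : ℂ) • 1) (fun n => (a n : ℂ) • 1)
    (fun n => (hL n).symm) (fun n => by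
      rw [hR, Matrix.conjTranspose_smul, Matrix.conjTranspose_one, Complex.star_def,
        Complex.conj_ofReal]) n hn).1
  have h2 := congrFun (congrFun h1 0) 0
  have hcomm (A B : Mat 1) : comm A B = 0 := by
    ext i j
    rw [Subsingleton.elim i 0, Subsingleton.elim j 0]
    simp [comm, Matrix.mul_apply, mul_comm]
  rw [hcomm] at h2
  simp only [zero_add, Matrix.sub_apply, Matrix.add_apply, Matrix.mul_apply, Finset.univ_unique,
    Finset.sum_singleton, Fin.default_eq_zero, Matrix.smul_apply, Matrix.one_apply_eq, smul_eq_mul,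
    mul_one, Matrix.neg_apply, Matrix.zero_apply, zero_mul, add_zero] at h2
  have h3 : (n : ℝ) * a n + k * a (n + 1) - a (n - 1) * -k
      = k * (a (n + 1) * a n * a n + a n * a (n - 1) * a n) := by exact_mod_cast h2
  field_simp
  linarith

end SzegoMatrix

end

theorem mainTheorem6 :
    (∀ (N : ℕ) (Wm2 Wm1 W0 : SzegoMatrix.Mat N) (w : ℂ → SzegoMatrix.Mat N),
      SzegoMatrix.MonodromyFree (SzegoMatrix.laurentW Wm2 Wm1 W0) →
      SzegoMatrix.IsAnnulusWeight w →
      (∀ z : ℂ, z ≠ 0 →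
        SzegoMatrix.rightLogDeriv w z = SzegoMatrix.laurentW Wm2 Wm1 W0 z) →
      SzegoMatrix.QuasiDefinite w →
      ∀ (α β : ℕ → SzegoMatrix.Mat N),
        (∀ n, α n = SzegoMatrix.verblunskyL1 w n) →
        (∀ n, β n = (SzegoMatrix.verblunskyR2 w n)ᴴ) →
        ∀ n : ℕ, 1 ≤ n →
          ((Wm1 + (n : ℂ) • 1) * α n + W0 * α (n + 1) - α (n - 1) * Wm2
            = W0 * (α (n + 1) * β n * α n + α n * β (n - 1) * α n)
              + SzegoMatrix.comm W0 (∑ m ∈ Finset.Icc 1 (n - 1), α m * β (m - 1)) * α n) ∧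
          (β n * (Wm1 + (n : ℂ) • 1) + β (n - 1) * W0 - Wm2 * β (n + 1)
            = (β n * α n * β (n - 1) + β n * α (n + 1) * β n) * W0
              + β n * SzegoMatrix.comm W0
                  (∑ m ∈ Finset.Icc 1 (n + 1), α m * β (m - 1)))) ∧
    (∀ (k : ℝ) (w : ℂ → SzegoMatrix.Mat 1),
      SzegoMatrix.IsAnnulusWeight w →
      (∀ z : ℂ, z ≠ 0 →
        SzegoMatrix.rightLogDeriv w z
          = SzegoMatrix.laurentW (-((k : ℂ) • 1)) 0 ((k : ℂ) • 1) z) →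
      SzegoMatrix.QuasiDefinite w ∧
      ∃ a : ℕ → ℝ,
        (∀ n, SzegoMatrix.verblunskyL1 w n = (a n : ℂ) • 1) ∧
        (∀ n, SzegoMatrix.verblunskyR2 w n = (a n : ℂ) • 1) ∧
        ∀ n : ℕ, 1 ≤ n →
          1 - a n ^ 2 ≠ 0 ∧
          (n : ℝ) * (a n / (1 - a n ^ 2)) + k * (a (n + 1) + a (n - 1)) = 0) := by
  exact ⟨fun _ _ _ _ _ _ hw hW hq α β hα hβ n hn =>
      SzegoMatrix.painleve_of_quasiDefinite hw hW hq α β hα hβ n hn,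
    fun _ _ hw hW => SzegoMatrix.scalar_reduction hw hW⟩
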